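/- Let $Q$ be a smooth $n$-manifold (Hausdorff, second countable), $\pi:T^1_kQ=TQ\oplus_Q\overset{k}{\cdots}\oplus_Q TQ\to Q$ its $k$-tangent bundle, with vertical endomorphisms $J^\alpha$ and Liouville vector field $\Delta$, and let $\mathcal L\in C^\infty(T^1_kQ)$ be a Lagrangian. Put $\theta^\alpha_{\mathcal L}=(J^\alpha)^*d\mathcal L$, $\omega^\alpha_{\mathcal L}=-d\theta^\alpha_{\mathcal L}$, $\mathcal E_{\mathcal L}=\Delta(\mathcal L)-\mathcal L$, and $\mathbf\Omega_{\mathcal L}(\mathbf X)=\sum_\alpha i(X_\alpha)\omega^\alpha_{\mathcal L}$ for a $k$-vector field (or a $k$-vector at a point) $\mathbf X=(X_1,\dots,X_k)$ on $T^1_kQ$. For a set $\mathfrak S$ of $k$-vector fields let $\mathfrak S^\perp$ be the set of smooth vector fields $Z$ on $T^1_kQ$ with $\mathbf\Omega_{\mathcal L}(\mathbf Y)(Z)=0$ for all $\mathbf Y\in\mathfrak S$. Let $\mathfrak X^k$ be the set of all smooth $k$-vector fields on $T^1_kQ$, $\mathfrak X^{kV}$ the set of those whose components are all $\pi$-vertical,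 and $\mathfrak M=[\mathfrak X^{kV}]^\perp$. At a point $x$ let $\mathfrak M_x\subseteq T_x(T^1_kQ)$ be the annihilator of all $\pi$-vertical $k$-vectors at $x$ (the $z$ with $\mathbf\Omega_{\mathcal L}(\mathbf V)_x(z)=0$ for all of them), and let $\mathfrak K_x=\bigcap_\alpha\ker(\omega^\alpha_{\mathcal L})_x$ be the annihilator of all $k$-vectors at $x$. Let $P_1$ be the set of points $x$ at which $(d\mathcal E_{\mathcal L})_x$ is in the image of $(\mathbf\Omega_{\mathcal L})_x$. Let $\mathbf X$ solve $\mathbf\Omega_{\mathcal L}(\mathbf X)=d\mathcal E_{\mathcal L}$ at the points of $P_1$, and let $$S_1=\Big\{x\in P_1 : \exists\,\mathbf Y\in\ker(\mathbf\Omega_{\mathcal L})_x,\ \sum_\alpha J^\alpha(X_\alpha+Y_\alpha)_x=\Delta_x\Big\}.$$ Then for every SOPDE $\mathbf\Gamma$, i.e. every smooth $k$-vector field on $T^1_kQ$ with $T\pi(\Gamma_\alpha(q;v_1,\dots,v_k))=v_\alpha$ for all $\alpha$: 1. $S_1=\{x : (\mathbf\Omega_{\mathcal L}(\mathbf\Gamma)-d\mathcal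 E_{\mathcal L})_x(z)=0 \text{ for all } z\in\mathfrak M_x\}$. If $\dim\mathfrak M_x$ is locally constant, then $$S_1=\{x\in T^1_kQ : i(Z)(\mathbf\Omega_{\mathcal L}(\mathbf\Gamma)-d\mathcal E_{\mathcal L})(x)=0\ \text{ for all } Z\in\mathfrak M\}.$$ 2. (Dynamical constraints.) $[\mathfrak X^k]^\perp\subseteq\mathfrak M$, and for $Z\in[\mathfrak X^k]^\perp$ one has $i(Z)(\mathbf\Omega_{\mathcal L}(\mathbf\Gamma)-d\mathcal E_{\mathcal L})=-\zeta^{(Z)}$, where $\zeta^{(Z)}=i(Z)d\mathcal E_{\mathcal L}$ are the dynamical constraints. If $\dim\mathfrak K_x$ is locally constant, then $P_1=\{x : \zeta^{(Z)}(x)=0\text{ for all }Z\in[\mathfrak X^k]^\perp\}$. 3. (SOPDE, or non-dynamical, constraints.) For $Z\in\mathfrak M\smallsetminus[\mathfrak X^k]^\perp$ one has $i(Z)(\mathbf\Omega_{\mathcal L}(\mathbf\Gamma)-d\mathcal E_{\mathcal L})=\eta^{(Z)}$ on $P_1$, where $\eta^{(Z)}=i(Z)\mathbf\Omega_{\mathcal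 L}(\mathbf\Gamma-\mathbf X)$ are the SOPDE constraints. If $\dim\mathfrak M_x$ is locally constant, then $S_1=\{x\in P_1 : \eta^{(Z)}(x)=0\text{ for all }Z\in\mathfrak M\smallsetminus[\mathfrak X^k]^\perp\}$. -/

import Mathlib

open Set Bundle
open scoped Manifold ContDiff Topology

noncomputable section

/-! ### The `k`-tangent bundle `T¹ₖQ = TQ ⊕ ⋯ ⊕ TQ` of a manifold -/

theorem contDiff_piMap_const {E : Type*} [NormedAddCommGroup E] [NormedSpace ℝ E] (k : ℕ) :
    ContDiff ℝ ∞ (fun A : E →L[ℝ] E =>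
      (ContinuousLinearMap.piMap fun _ : Fin k => A : (Fin k → E) →L[ℝ] (Fin k → E))) := by
  have : (fun A : E →L[ℝ] E =>
      (ContinuousLinearMap.piMap fun _ : Fin k => A : (Fin k → E) →L[ℝ] (Fin k → E))) =
      fun A => ∑ a : Fin k, ((ContinuousLinearMap.single ℝ (fun _ : Fin k => E) a).comp A).comp
        (ContinuousLinearMap.proj a) := by
    funext A
    ext v a
    simp [Finset.sum_apply, Pi.single_apply]
  rw [this]
  fun_prop

section KTangent

variable {E : Type*} [NormedAddCommGroup E] [NormedSpace ℝ E]
  {H : Type*} [TopologicalSpace H] (I : ModelWithCorners ℝ E H)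
  (Q : Type*) [TopologicalSpace Q] [ChartedSpace H Q] (k : ℕ)

/-- The vector bundle core of the Whitney sum of `k` copies of the tangent bundle: the coordinate
changes of the tangent bundle act on each of the `k` summands. -/
def kTangentBundleCore [IsManifold I 1 Q] : VectorBundleCore ℝ Q (Fin k → E) (atlas H Q) where
  baseSet := (tangentBundleCore I Q).baseSet
  isOpen_baseSet := (tangentBundleCore I Q).isOpen_baseSet
  indexAt := (tangentBundleCore I Q).indexAt
  mem_baseSet_at := (tangentBundleCore I Q).mem_baseSet_at
  coordChange i j x :=
    ContinuousLinearMap.piMap fun _ => (tangentBundleCore I Q).coordChange i j x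
  coordChange_self i x hx v := by
    funext a
    exact (tangentBundleCore I Q).coordChange_self i x hx (v a)
  continuousOn_coordChange i j := by
    have h := (tangentBundleCore I Q).continuousOn_coordChange i j
    exact (contDiff_piMap_const k).continuous.comp_continuousOn h
  coordChange_comp i j l x hx v := by
    funext a
    exact (tangentBundleCore I Q).coordChange_comp i j l x hx (v a)

variable {Q}

/-- The fibre of `T¹ₖQ` at `q`: `k`-tuples of tangent vectors at `q`. -/
def KTangentSpace (q : Q) : Type _ := Fin k → TangentSpace I q

instance (q : Q) : TopologicalSpace (KTangentSpace I k q) :=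
  inferInstanceAs (TopologicalSpace (Fin k → E))
instance (q : Q) : AddCommGroup (KTangentSpace I k q) :=
  inferInstanceAs (AddCommGroup (Fin k → E))
instance (q : Q) : Module ℝ (KTangentSpace I k q) :=
  inferInstanceAs (Module ℝ (Fin k → E))

variable (Q)

/-- The `k`-tangent bundle `T¹ₖQ`; a point is `⟨q, v⟩` with `v : Fin k → T_q Q`. -/
abbrev KTangentBundle : Type _ := TotalSpace (Fin k → E) (KTangentSpace I k : Q → Type _)

section

variable [IsManifold I 1 Q]

instance : TopologicalSpace (KTangentBundle I Q k) :=
  inferInstanceAs (TopologicalSpace (kTangentBundleCore I Q k).TotalSpace)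

instance : FiberBundle (Fin k → E) (KTangentSpace I k : Q → Type _) :=
  inferInstanceAs (FiberBundle (Fin k → E) (kTangentBundleCore I Q k).Fiber)

instance : VectorBundle ℝ (Fin k → E) (KTangentSpace I k : Q → Type _) :=
  inferInstanceAs (VectorBundle ℝ (Fin k → E) (kTangentBundleCore I Q k).Fiber)

end

instance [h : IsManifold I ∞ Q] :
    ContMDiffVectorBundle ∞ (Fin k → E) (KTangentSpace I k : Q → Type _) I := by
  have : IsManifold I (∞ + 1) Q := h
  have : (kTangentBundleCore I Q k).IsContMDiff I ∞ := by
    have : (tangentBundleCore I Q).IsContMDiff I ∞ := tangentBundleCore.isContMDiff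
    refine ⟨fun i j => ?_⟩
    have h' := (tangentBundleCore I Q).contMDiffOn_coordChange I (n := ∞) i j
    exact (contDiff_piMap_const k).contMDiff.comp_contMDiffOn h'
  exact (kTangentBundleCore I Q k).instContMDiffVectorBundle

end KTangent

/-! ### Exterior derivative of 1-forms, smooth vector fields -/

section Manifold

variable {E : Type*} [NormedAddCommGroup E] [NormedSpace ℝ E]
  {H : Type*} [TopologicalSpace H] (I : ModelWithCorners ℝ E H)
  {M : Type*} [TopologicalSpace M] [ChartedSpace H M]

/-- The exterior derivative of a 1-form on a manifold without boundary: read the form in the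
preferred chart `φ` around `x`, differentiate there, and pull the result back by `Dφ`. -/
def extDerivOneForm (θ : ∀ x : M, TangentSpace I x →L[ℝ] ℝ) (x : M) :
    TangentSpace I x [⋀^Fin 2]→L[ℝ] ℝ :=
  ContinuousAlternatingMap.compContinuousLinearMap
    (extDeriv (fun y : E => ContinuousAlternatingMap.ofSubsingleton ℝ E ℝ (0 : Fin 1)
      ((θ ((extChartAt I x).symm y)).comp (mfderiv 𝓘(ℝ, E) I (extChartAt I x).symm y)))
      (extChartAt I x x))
    (mfderiv I 𝓘(ℝ, E) (extChartAt I x) x)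

variable (M)

/-- Smooth vector fields `𝔛(M)`. -/
abbrev VField [IsManifold I 1 M] : Type _ := Cₛ^∞⟮I; E, (TangentSpace I : M → Type _)⟯

/-- `k`-vector fields `𝔛ᵏ(M)`, as `k`-tuples of smooth vector fields. -/
abbrev KVField [IsManifold I 1 M] (k : ℕ) : Type _ := Fin k → VField I M

end Manifold

theorem update_pair_one {V : Type*} (u a b : V) : Function.update ![u, b] 1 a = ![u, a] := by
  funext i
  fin_cases i <;> rfl

/-- The contraction `i(u)σ` of a 2-form with a vector: `z ↦ σ(u, z)`. -/
def contract {V : Type*} [AddCommGroup V] [Module ℝ V] [TopologicalSpace V]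
    (σ : V [⋀^Fin 2]→L[ℝ] ℝ) (u : V) : V →ₗ[ℝ] ℝ where
  toFun z := σ ![u, z]
  map_add' a b := by
    have h := σ.map_update_add ![u, 0] 1 a b
    simp only [update_pair_one] at h
    exact h
  map_smul' c a := by
    have h := σ.map_update_smul ![u, 0] 1 c a
    simp only [update_pair_one] at h
    exact h

/-! ### `k`-symplectic Lagrangian formalism -/

namespace KSymplectic

variable (n k : ℕ) (Q : Type*) [TopologicalSpace Q] [ChartedSpace (EuclideanSpace ℝ (Fin n)) Q]
  [IsManifold (𝓡 n) ∞ Q]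

/-- The model with corners of `T¹ₖQ`. -/
abbrev J : ModelWithCorners ℝ
    (EuclideanSpace ℝ (Fin n) × (Fin k → EuclideanSpace ℝ (Fin n)))
    (ModelProd (EuclideanSpace ℝ (Fin n)) (Fin k → EuclideanSpace ℝ (Fin n))) :=
  (𝓡 n).prod 𝓘(ℝ, Fin k → EuclideanSpace ℝ (Fin n))

/-- The manifold `T¹ₖQ`. -/
abbrev T : Type _ := KTangentBundle (𝓡 n) Q k

variable {n k Q}

/-- The tangent space of `T¹ₖQ` at `x`. -/
abbrev TS (x : T n k Q) : Type _ := TangentSpace (J n k) x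

/-- The vector `v_α` of the point `x = (q; v₁, …, vₖ)`. -/
def vel (x : T n k Q) (α : Fin k) : TangentSpace (𝓡 n) x.proj := x.snd α

/-- The derivative of the projection `π : T¹ₖQ → Q`. -/
def dπ (x : T n k Q) : TS x →L[ℝ] TangentSpace (𝓡 n) x.proj :=
  mfderiv (J n k) (𝓡 n) (fun y : T n k Q => y.proj) x

/-- The inclusion `w ↦ (q; w)` of the fibre over `q` into `T¹ₖQ`. -/
def fibreIncl (q : Q) (w : Fin k → EuclideanSpace ℝ (Fin n)) : T n k Q := ⟨q, w⟩

/-- The derivative at `x = (q; v)` of the inclusion of the fibre through `x`: it sends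
`w = (w₁, …, wₖ)` to the velocity at `t = 0` of the curve `t ↦ (q; v₁ + t w₁, …, vₖ + t wₖ)`. -/
def fibreDeriv (x : T n k Q) : (Fin k → TangentSpace (𝓡 n) x.proj) →L[ℝ] TS x :=
  mfderiv 𝓘(ℝ, Fin k → EuclideanSpace ℝ (Fin n)) (J n k)
    (fibreIncl x.proj) (vel x)

/-- The vertical `α`-lift to `x = (q; v₁, …, vₖ)`: it sends `w ∈ T_q Q` to the velocity at `t = 0`
of the curve `t ↦ (q; v₁, …, v_α + t w, …, vₖ)`. -/
def vlift (α : Fin k) (x : T n k Q) : TangentSpace (𝓡 n) x.proj →L[ℝ] TS x :=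
  (fibreDeriv x).comp (ContinuousLinearMap.single ℝ (fun _ : Fin k => TangentSpace (𝓡 n) x.proj) α)

/-- The vertical endomorphism `J^α`. -/
def vendo (α : Fin k) (x : T n k Q) : TS x →L[ℝ] TS x := (vlift α x).comp (dπ x)

/-- The Liouville vector field `Δ`. -/
def liouville (x : T n k Q) : TS x := ∑ α, vlift α x (vel x α)

/-- The differential of a function on `T¹ₖQ`. -/
def dfun (f : T n k Q → ℝ) (x : T n k Q) : TS x →L[ℝ] ℝ := mfderiv (J n k) 𝓘(ℝ, ℝ) f x

/-- The Cartan 1-forms `θ^α_L = (J^α)^* dL`. -/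
def cartanOne (L : T n k Q → ℝ) (α : Fin k) (x : T n k Q) : TS x →L[ℝ] ℝ :=
  (dfun L x).comp (vendo α x)

/-- The Cartan 2-forms `ω^α_L = -dθ^α_L`. -/
def cartanTwo (L : T n k Q → ℝ) (α : Fin k) (x : T n k Q) : TS x [⋀^Fin 2]→L[ℝ] ℝ :=
  -extDerivOneForm (J n k) (cartanOne L α) x

/-- The Lagrangian energy `E_L = Δ(L) - L`. -/
def energy (L : T n k Q → ℝ) (x : T n k Q) : ℝ := dfun L x (liouville x) - L x

/-- `Ω_L(X) = ∑_α i(X_α) ω^α_L` at the point `x`, for a `k`-vector `X = (X₁, …, Xₖ)` at `x`. -/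
def kOmega (L : T n k Q → ℝ) (x : T n k Q) (X : Fin k → TS x) : TS x →ₗ[ℝ] ℝ :=
  ∑ α, contract (cartanTwo L α x) (X α)

/-- A `k`-vector `X` at `x` solves the Lagrangian equation `Ω_L(X) = dE_L` at `x`. -/
def SolvesAt (L : T n k Q → ℝ) (x : T n k Q) (X : Fin k → TS x) : Prop :=
  kOmega L x X = (dfun (energy L) x : TS x →ₗ[ℝ] ℝ)

/-- `P₁`: the set of points at which `dE_L` is in the image of `Ω_L`. -/
def P₁ (L : T n k Q → ℝ) : Set (T n k Q) := {x | ∃ X : Fin k → TS x, SolvesAt L x X}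

/-- `S₁`, for a (pointwise) solution `X` of the Lagrangian equation on `P₁`: the points of `P₁` at
which some element of the kernel of `Ω_L` can be added to `X` to give `∑_α J^α(X_α + Y_α) = Δ`. -/
def S₁ (L : T n k Q → ℝ) (X : ∀ x : T n k Q, Fin k → TS x) : Set (T n k Q) :=
  {x ∈ P₁ L | ∃ Y : Fin k → TS x, kOmega L x Y = 0 ∧
    ∑ α, vendo α x (X x α + Y α) = liouville x}

/-- A `k`-vector field `Γ` on `T¹ₖQ` is a SOPDE if it is a section of `T¹ₖπ`, that is,
`T¹ₖπ (Γ₁, …, Γₖ)(x) = (Tπ Γ₁(x), …, Tπ Γₖ(x)) = x` for every `x`. -/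
def IsSOPDE (Γ : KVField (J n k) (T n k Q) k) : Prop := ∀ x α, dπ x (Γ α x) = vel x α

/-- The annihilator `𝔖^⊥` of a set `𝔖` of `k`-vector fields: the vector fields `Z` such that
`Ω_L(Y)(Z) = 0` for all `Y ∈ 𝔖`. -/
def annihilator (L : T n k Q → ℝ) (S : Set (KVField (J n k) (T n k Q) k)) :
    Set (VField (J n k) (T n k Q)) :=
  {Z | ∀ Y ∈ S, ∀ x, kOmega L x (fun α => Y α x) (Z x) = 0}

/-- The `π`-vertical `k`-vector fields `𝔛^{kV}(T¹ₖQ)`. -/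
def verticalFields : Set (KVField (J n k) (T n k Q) k) := {V | ∀ α x, dπ x (V α x) = 0}

/-- `𝔐 = [𝔛^{kV}(T¹ₖQ)]^⊥`. -/
def 𝔐 (L : T n k Q → ℝ) : Set (VField (J n k) (T n k Q)) := annihilator L verticalFields

/-- `[𝔛ᵏ(T¹ₖQ)]^⊥`. -/
def kPerp (L : T n k Q → ℝ) : Set (VField (J n k) (T n k Q)) := annihilator L univ

/-- The annihilator in `T_x(T¹ₖQ)` of a set of `k`-vectors at `x`. -/
def annihilatorAt (L : T n k Q → ℝ) (x : T n k Q) (S : Set (Fin k → TS x)) :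
    Submodule ℝ (TS x) := ⨅ Y ∈ S, LinearMap.ker (kOmega L x Y)

/-- `𝔐_x`: the annihilator of all `π`-vertical `k`-vectors at `x`. -/
def 𝔐At (L : T n k Q → ℝ) (x : T n k Q) : Submodule ℝ (TS x) :=
  annihilatorAt L x {V | ∀ α, dπ x (V α) = 0}

/-- The annihilator of all `k`-vectors at `x`. -/
def kPerpAt (L : T n k Q → ℝ) (x : T n k Q) : Submodule ℝ (TS x) := annihilatorAt L x univ

/-- A family of subspaces of the tangent spaces of `T¹ₖQ` has locally constant rank. -/
def LocConstRank (D : ∀ x : T n k Q, Submodule ℝ (TS x)) : Prop :=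
  IsLocallyConstant fun x => Module.finrank ℝ (D x)

/-- The covector `(Ω_L(Γ) - dE_L)(x)`. -/
def defect (L : T n k Q → ℝ) (Γ : KVField (J n k) (T n k Q) k) (x : T n k Q) : TS x →ₗ[ℝ] ℝ :=
  kOmega L x (fun α => Γ α x) - (dfun (energy L) x : TS x →ₗ[ℝ] ℝ)

/-- The first generation dynamical constraint `ζ^{(Z)} = i(Z) dE_L`. -/
def dynConstraint (L : T n k Q → ℝ) (Z : VField (J n k) (T n k Q)) (x : T n k Q) : ℝ :=
  dfun (energy L) x (Z x)

/-- The first generation SOPDE (non-dynamical) constraint `η^{(Z)} = i(Z) Ω_L(Γ - X)`. -/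
def sopdeConstraint (L : T n k Q → ℝ) (Γ : KVField (J n k) (T n k Q) k)
    (X : ∀ x : T n k Q, Fin k → TS x) (Z : VField (J n k) (T n k Q)) (x : T n k Q) : ℝ :=
  kOmega L x (fun α => Γ α x - X x α) (Z x)

end KSymplectic

end

/-! Fix x and a SOPDE Γ. Since J^α factors through Tπ and the derivative of the fibre inclusion is
injective, ∑ J^α(W_α) = Δ says exactly that W has the same projection as Γ, i.e. that Γ − W is
vertical. Hence x ∈ S₁ iff Ω_L(Γ) − dE_L is the image under Ω_L of a vertical k-vector
(`mem_S₁_iff`), a condition in which X no longer occurs. The image of a subspace under Ω_L is the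
set of covectors vanishing on its annihilator, by finite-dimensional biduality
(`forall_mem_annAt_iff_exists`). For vertical k-vectors this describes S₁; for all k-vectors it
describes P₁.

To test with global vector fields instead of vectors, each vector of the annihilator at x must be
the value of a smooth field in the annihilator (`IsChartConstant.exists_mem_annFields`). In a bundle
chart the annihilator is the kernel of a smooth family of linear maps, and a kernel of locally
constant dimension has enough smooth local sections (`exists_contDiffOn_mem_ker`); a bump function
makes them global. The charts enter only to show that the coefficients of ω^α_L are smooth and that
the vertical subspace is constant.

The constraints then follow by linearity: on P₁ one has dE_L = Ω_L(X), and Ω_L(·)(Z) vanishes for Z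
∈ [𝔛ᵏ]^⊥. -/

noncomputable section

/-! ### Kernels of constant rank -/

section KernelSection

variable {F G : Type*} [NormedAddCommGroup F] [NormedSpace ℝ F] [FiniteDimensional ℝ F]
  [NormedAddCommGroup G] [NormedSpace ℝ G] [FiniteDimensional ℝ G]

/-- If the kernel of a smooth family of linear maps has constant dimension, each vector in one of
the kernels extends to a smooth local section of the kernels. -/
theorem exists_contDiffOn_mem_ker {A : F → F →L[ℝ] G} {s : Set F} (hs : IsOpen s)
    (hA : ContDiffOn ℝ ∞ A s) {y₀ : F} (hy₀ : y₀ ∈ s)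
    (hrank : ∀ y ∈ s, Module.finrank ℝ (A y : F →ₗ[ℝ] G).ker =
      Module.finrank ℝ (A y₀ : F →ₗ[ℝ] G).ker)
    {z₀ : F} (hz₀ : A y₀ z₀ = 0) :
    ∃ t : Set F, IsOpen t ∧ t ⊆ s ∧ y₀ ∈ t ∧ ∃ z : F → F, ContDiffOn ℝ ∞ z t ∧ z y₀ = z₀ ∧
      ∀ y ∈ t, A y (z y) = 0 := by
  let R := (A y₀ : F →ₗ[ℝ] G).range
  obtain ⟨P', hP'⟩ := R.subtype.exists_leftInverse_of_injective R.ker_subtype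
  obtain ⟨S', hS'⟩ := (A y₀ : F →ₗ[ℝ] G).rangeRestrict.exists_rightInverse_of_surjective
    (LinearMap.range_rangeRestrict _)
  let P : G →L[ℝ] R := P'.toContinuousLinearMap
  let S : R →L[ℝ] F := S'.toContinuousLinearMap
  -- `B` is the identity at `y₀`, hence invertible nearby. Subtracting `S (B y)⁻¹ P (A y z₀)` from
  -- `z₀` corrects it to a vector killed by `P ∘ A y`.
  let B : F → R →L[ℝ] R := fun y => P.comp ((A y).comp S)
  have hB : ContDiffOn ℝ ∞ B s := contDiffOn_const.clm_comp (hA.clm_comp contDiffOn_const)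
  have hB₀ : B y₀ = 1 := by
    ext r : 1
    have h1 : A y₀ (S r) = (r : G) := congrArg Subtype.val (LinearMap.congr_fun hS' r)
    have h2 : P (r : G) = r := LinearMap.congr_fun hP' r
    change P (A y₀ (S r)) = r
    rw [h1, h2]
  let t := s ∩ B ⁻¹' {b | IsUnit b}
  have ht : IsOpen t := hB.continuousOn.isOpen_inter_preimage hs (Units.isOpen (R := R →L[ℝ] R))
  refine ⟨t, ht, inter_subset_left, ⟨hy₀, by simp [hB₀]⟩,
    fun y => z₀ - S (Ring.inverse (B y) (P (A y z₀))), ?_, ?_, ?_⟩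
  · intro y hy
    have hA' : ContDiffWithinAt ℝ ∞ A t y := (hA y hy.1).mono inter_subset_left
    have hB' : ContDiffWithinAt ℝ ∞ B t y := (hB y hy.1).mono inter_subset_left
    obtain ⟨b, hb⟩ := hy.2
    have hinv : ContDiffWithinAt ℝ ∞ (fun y => Ring.inverse (B y)) t y := by
      have := contDiffAt_ringInverse ℝ (n := ∞) (R := R →L[ℝ] R) b
      rw [hb] at this
      exact this.comp_contDiffWithinAt y hB'
    exact contDiffWithinAt_const.sub (S.contDiff.comp_contDiffWithinAt
      (hinv.clm_apply (P.contDiff.comp_contDiffWithinAt (hA'.clm_apply contDiffWithinAt_const))))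
  · simp [hz₀]
  · intro y hy
    let C : F →ₗ[ℝ] R := (P : G →ₗ[ℝ] R) ∘ₗ (A y : F →ₗ[ℝ] G)
    have hBinv : ∀ r, B y (Ring.inverse (B y) r) = r := fun r =>
      congrArg (fun T : R →L[ℝ] R => T r) (Ring.mul_inverse_cancel (B y) hy.2)
    have hC : C.range = ⊤ :=
      LinearMap.range_eq_top.2 fun r => ⟨S (Ring.inverse (B y) r), hBinv r⟩
    have hle : (A y : F →ₗ[ℝ] G).ker ≤ C.ker := LinearMap.ker_le_ker_comp _ _
    have h1 := C.finrank_range_add_finrank_ker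
    have h2 := (A y₀ : F →ₗ[ℝ] G).finrank_range_add_finrank_ker
    have h3 := hrank y hy.1
    rw [hC, finrank_top] at h1
    have h4 : Module.finrank ℝ R = Module.finrank ℝ (A y₀ : F →ₗ[ℝ] G).range := rfl
    -- `P ∘ A y` is onto `R`, so its kernel has the dimension of `ker (A y₀)`, which by `hrank` is
    -- that of `ker (A y)`: being killed by `P ∘ A y` is enough.
    have hker := Submodule.eq_of_le_of_finrank_eq hle (by omega)
    have : z₀ - S (Ring.inverse (B y) (P (A y z₀))) ∈ C.ker := by
      rw [LinearMap.mem_ker, map_sub, sub_eq_zero]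
      exact (hBinv (P (A y z₀))).symm
    rw [← hker] at this
    exact this

end KernelSection

/-! ### Hausdorff total spaces -/

/-- Points over the same base point lie in one trivialization; other points are separated by their
projections. The extension of local fields by bump functions needs this for T¹ₖQ. -/
theorem FiberBundle.t2Space_totalSpace {B F : Type*} [TopologicalSpace B] [TopologicalSpace F]
    [T2Space B] [T2Space F] {V : B → Type*} [TopologicalSpace (TotalSpace F V)]
    [∀ b, TopologicalSpace (V b)] [FiberBundle F V] : T2Space (TotalSpace F V) := by
  refine ⟨fun x y hxy => ?_⟩
  by_cases h : x.proj = y.proj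
  · let e := trivializationAt F V x.proj
    have hx : x ∈ e.source := FiberBundle.mem_trivializationAt_proj_source
    have hy : y ∈ e.source := by
      rw [e.mem_source, ← h]
      exact mem_baseSet_trivializationAt F V x.proj
    obtain ⟨u, v, hu, hv, hxu, hyv, huv⟩ := t2_separation (fun he => hxy (e.injOn hx hy he))
    refine ⟨e.source ∩ e ⁻¹' u, e.source ∩ e ⁻¹' v,
      e.continuousOn.isOpen_inter_preimage e.open_source hu,
      e.continuousOn.isOpen_inter_preimage e.open_source hv, ⟨hx, hxu⟩, ⟨hy, hyv⟩, ?_⟩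
    exact (huv.preimage e).mono inter_subset_right inter_subset_right
  · obtain ⟨u, v, hu, hv, hxu, hyv, huv⟩ := t2_separation h
    have hc := FiberBundle.continuous_proj F V
    exact ⟨_, _, hu.preimage hc, hv.preimage hc, hxu, hyv, huv.preimage _⟩

/-! ### Vector fields and 1-forms in charts -/

section Charts

variable {E : Type*} [NormedAddCommGroup E] [NormedSpace ℝ E]
  {H : Type*} [TopologicalSpace H] (I : ModelWithCorners ℝ E H)
  {M : Type*} [TopologicalSpace M] [ChartedSpace H M]

/-- A smooth local vector field, given by its components in a chart, extends to a global vector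
field after multiplication with a bump function. -/
theorem exists_vField_mfderiv_extChartAt_eq [FiniteDimensional ℝ E] [T2Space M]
    [IsManifold I ∞ M] (x₀ : M) {u : Set M} (hu : IsOpen u) (hx₀ : x₀ ∈ u)
    (hsub : u ⊆ (chartAt H x₀).source) {f : M → E} (hf : ContMDiffOn I 𝓘(ℝ, E) ∞ f u) :
    ∃ (Z : VField I M) (ψ : M → ℝ), ψ x₀ = 1 ∧ (∀ x ∉ u, Z x = 0) ∧
      ∀ x ∈ u, mfderiv I 𝓘(ℝ, E) (extChartAt I x₀) x (Z x) = ψ x • f x := by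
  let e := trivializationAt E (TangentSpace I : M → Type _) x₀
  have he : e.baseSet = (chartAt H x₀).source := TangentBundle.trivializationAt_baseSet x₀
  let s : ∀ x : M, TangentSpace I x := fun x => e.symmL ℝ x (f x)
  have hes : ∀ x ∈ u, e.continuousLinearMapAt ℝ x (s x) = f x := fun x hx =>
    e.continuousLinearMapAt_symmL (he ▸ hsub hx) (f x)
  have hs : ContMDiffOn I (I.prod 𝓘(ℝ, E)) ∞ (fun x => TotalSpace.mk' E x (s x)) u := by
    have : IsManifold I (∞ + 1) M := ‹IsManifold I ∞ M›
    rw [e.contMDiffOn_section_iff hu (he ▸ hsub)]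
    refine hf.congr fun x hx => ?_
    rw [← hes x hx, e.continuousLinearMapAt_apply ℝ, e.linearMapAt_apply, if_pos (he ▸ hsub hx)]
  -- The bump function only rescales `f`, which is harmless because the result is used for
  -- membership in linear subspaces.
  obtain ⟨ψ, hψu, -⟩ := ((SmoothBumpFunction.nhds_basis_support (I := I)
    (hu.mem_nhds hx₀)).mem_iff).1 (hu.mem_nhds hx₀)
  refine ⟨⟨(ψ : M → ℝ) • s, ?_⟩, ψ, ψ.eq_one, fun x hx => ?_, fun x hx => ?_⟩
  · exact ContMDiffOn.smul_section_of_tsupport ψ.contMDiff.contMDiffOn hu hψu hs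
  · have : ψ x = 0 := image_eq_zero_of_notMem_tsupport fun h => hx (hψu h)
    change ψ x • s x = 0
    rw [this, zero_smul]
  · change mfderiv I 𝓘(ℝ, E) (extChartAt I x₀) x (ψ x • s x) = ψ x • f x
    rw [map_smul, ← TangentBundle.continuousLinearMapAt_trivializationAt (hsub hx)]
    exact congrArg (ψ x • ·) (hes x hx)

variable {I}

/-- The coordinate expression of a 1-form in the chart at `x₀`. -/
def chartOneForm (θ : ∀ x : M, TangentSpace I x →L[ℝ] ℝ) (x₀ : M) (y : E) : E →L[ℝ] ℝ :=
  (θ ((extChartAt I x₀).symm y)).comp (mfderiv 𝓘(ℝ, E) I (extChartAt I x₀).symm y)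

theorem mdifferentiableAt_extChartAt_symm [I.Boundaryless] [IsManifold I 1 M] {x₀ : M} {y : E}
    (hy : y ∈ (extChartAt I x₀).target) :
    MDifferentiableAt 𝓘(ℝ, E) I (extChartAt I x₀).symm y := by
  have := mdifferentiableWithinAt_extChartAt_symm (I := I) hy
  rwa [I.range_eq_univ, mdifferentiableWithinAt_univ] at this

theorem mfderiv_extChartAt_symm_apply_mfderiv [I.Boundaryless] [IsManifold I 1 M] {x₀ x : M}
    (hx : x ∈ (extChartAt I x₀).source) (v : TangentSpace I x) :
    (mfderiv 𝓘(ℝ, E) I (extChartAt I x₀).symm (extChartAt I x₀ x)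
      (mfderiv I 𝓘(ℝ, E) (extChartAt I x₀) x v) : E) = v := by
  have h := mfderivWithin_extChartAt_symm_comp_mfderiv_extChartAt' (I := I) hx
  rw [I.range_eq_univ, mfderivWithin_univ] at h
  exact congrArg (fun T : E →L[ℝ] E => T v) h

theorem mfderiv_extChartAt_apply_mfderiv_symm [I.Boundaryless] [IsManifold I 1 M] {x₀ x : M}
    (hx : x ∈ (extChartAt I x₀).source) (v : E) :
    (mfderiv I 𝓘(ℝ, E) (extChartAt I x₀) x
      (mfderiv 𝓘(ℝ, E) I (extChartAt I x₀).symm (extChartAt I x₀ x) v : E) : E) = v := by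
  have h := mfderiv_extChartAt_comp_mfderivWithin_extChartAt_symm' (I := I) hx
  rw [I.range_eq_univ, mfderivWithin_univ] at h
  exact congrArg (fun T : E →L[ℝ] E => T v) h

theorem chartOneForm_apply_mfderiv [I.Boundaryless] [IsManifold I 1 M]
    (θ : ∀ x : M, TangentSpace I x →L[ℝ] ℝ) {x₀ x : M}
    (hx : x ∈ (extChartAt I x₀).source) (v : TangentSpace I x) :
    chartOneForm θ x₀ (extChartAt I x₀ x) (mfderiv I 𝓘(ℝ, E) (extChartAt I x₀) x v) = θ x v := by
  have h := mfderiv_extChartAt_symm_apply_mfderiv hx v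
  -- The tangent spaces at `φ.symm (φ x)` and at `x` are different types that both unfold to `E`;
  -- working in `E` avoids a transport.
  calc _ = (θ ((extChartAt I x₀).symm (extChartAt I x₀ x)) : E →L[ℝ] ℝ)
        (mfderiv 𝓘(ℝ, E) I (extChartAt I x₀).symm (extChartAt I x₀ x)
          (mfderiv I 𝓘(ℝ, E) (extChartAt I x₀) x v) : E) := rfl
    _ = (θ ((extChartAt I x₀).symm (extChartAt I x₀ x)) : E →L[ℝ] ℝ) v := by rw [h]
    _ = θ x v := congrArg (fun q : M => (θ q : E →L[ℝ] ℝ) v) ((extChartAt I x₀).left_inv hx)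

theorem extDeriv_ofSubsingleton_apply {g : E → E →L[ℝ] ℝ} {y : E}
    (hg : DifferentiableAt ℝ g y) (a b : E) :
    extDeriv (fun y => ContinuousAlternatingMap.ofSubsingleton ℝ E ℝ (0 : Fin 1) (g y)) y ![a, b] =
      fderiv ℝ g y a b - fderiv ℝ g y b a := by
  have hd : DifferentiableAt ℝ
      (fun y => ContinuousAlternatingMap.ofSubsingleton ℝ E ℝ (0 : Fin 1) (g y)) y :=
    (ContinuousAlternatingMap.ofSubsingletonLIE (𝕜 := ℝ) (E := E) (F := ℝ)
      (0 : Fin 1)).differentiableAt.comp y hg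
  rw [extDeriv_apply hd]
  have h (c : E) : fderiv ℝ (fun y => g y c) y = (fderiv ℝ g y).flip c := by
    ext d
    rw [fderiv_clm_apply hg (differentiableAt_const c)]
    simp
  simp [Fin.sum_univ_two, Fin.removeNth, h, sub_eq_add_neg]

/-- The exterior derivative of a 1-form can be computed in any chart. -/
theorem extDerivOneForm_apply [I.Boundaryless] [IsManifold I ∞ M]
    (θ : ∀ x : M, TangentSpace I x →L[ℝ] ℝ) {x₀ x : M} (hx : x ∈ (extChartAt I x₀).source)
    (hθ : DifferentiableAt ℝ (chartOneForm θ x₀) (extChartAt I x₀ x)) (u v : TangentSpace I x) :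
    extDerivOneForm I θ x ![u, v] =
      fderiv ℝ (chartOneForm θ x₀) (extChartAt I x₀ x)
          (mfderiv I 𝓘(ℝ, E) (extChartAt I x₀) x u) (mfderiv I 𝓘(ℝ, E) (extChartAt I x₀) x v) -
        fderiv ℝ (chartOneForm θ x₀) (extChartAt I x₀ x)
          (mfderiv I 𝓘(ℝ, E) (extChartAt I x₀) x v)
          (mfderiv I 𝓘(ℝ, E) (extChartAt I x₀) x u) := by
  let φ := extChartAt I x
  let φ₀ := extChartAt I x₀
  let τ : E → E := φ₀ ∘ φ.symm
  let η : E → E [⋀^Fin 1]→L[ℝ] ℝ := fun y =>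
    ContinuousAlternatingMap.ofSubsingleton ℝ E ℝ (0 : Fin 1) (chartOneForm θ x₀ y)
  have hφ : φ x ∈ φ.target := mem_extChartAt_target x
  have hφx : φ.symm (φ x) = x := extChartAt_to_inv x
  have hτx : τ (φ x) = φ₀ x := congrArg φ₀ hφx
  have hnhds : φ.target ∩ φ.symm ⁻¹' φ₀.source ∈ 𝓝 (φ x) :=
    ((continuousOn_extChartAt_symm x).isOpen_inter_preimage (isOpen_extChartAt_target x)
      (isOpen_extChartAt_source x₀)).mem_nhds ⟨hφ, by rw [mem_preimage, hφx]; exact hx⟩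
  have hfd : ∀ y ∈ φ.target ∩ φ.symm ⁻¹' φ₀.source, ∀ w : E, fderiv ℝ τ y w =
      (mfderiv I 𝓘(ℝ, E) φ₀ (φ.symm y) : E →L[ℝ] E) (mfderiv 𝓘(ℝ, E) I φ.symm y w : E) := by
    intro y hy w
    rw [← mfderiv_eq_fderiv]
    have h := mfderiv_comp y (mdifferentiableAt_extChartAt (I := I) (x := x₀)
      (by rw [← extChartAt_source (I := I)]; exact hy.2)) (mdifferentiableAt_extChartAt_symm hy.1)
    exact congrArg (fun T : E →L[ℝ] E => T w) h
  -- The definition uses a chart that varies with `x`. The local form in that chart is the pullback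
  -- by the transition map `τ` of the one in the fixed chart at `x₀`, and d commutes with pullback
  -- by a C² map.
  have heq : (fun y => ContinuousAlternatingMap.ofSubsingleton ℝ E ℝ (0 : Fin 1)
      (chartOneForm θ x y)) =ᶠ[𝓝 (φ x)]
      fun y => (η (τ y)).compContinuousLinearMap (fderiv ℝ τ y) := by
    filter_upwards [hnhds] with y hy
    ext w
    change θ (φ.symm y) (mfderiv 𝓘(ℝ, E) I φ.symm y (w 0)) =
      chartOneForm θ x₀ (φ₀ (φ.symm y)) (fderiv ℝ τ y (w 0))
    rw [hfd y hy]
    exact (chartOneForm_apply_mfderiv θ hy.2 _).symm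
  have hη : DifferentiableAt ℝ η (τ (φ x)) := by
    rw [hτx]
    exact (ContinuousAlternatingMap.ofSubsingletonLIE (𝕜 := ℝ) (E := E) (F := ℝ)
      (0 : Fin 1)).differentiableAt.comp _ hθ
  have hτ : ContDiffAt ℝ 2 τ (φ x) := by
    have h := contDiffWithinAt_ext_coord_change (I := I) (n := ∞) x₀ x (y := φ x)
      (mem_of_mem_nhds hnhds)
    rw [I.range_eq_univ, contDiffWithinAt_univ] at h
    exact h.of_le ENat.LEInfty.out
  have hd : ∀ w : E, fderiv ℝ τ (φ x) w = (mfderiv I 𝓘(ℝ, E) φ₀ x : E →L[ℝ] E) w := by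
    intro w
    have h := hfd _ (mem_of_mem_nhds hnhds) w
    have hid := mfderivWithin_range_extChartAt_symm (I := I) (x := x)
    rw [I.range_eq_univ, mfderivWithin_univ] at hid
    have hid' : (mfderiv 𝓘(ℝ, E) I φ.symm (φ x) w : E) = w :=
      congrArg (fun T : E →L[ℝ] E => T w) hid
    have h2 := congrArg (mfderiv I 𝓘(ℝ, E) φ₀ (φ.symm (φ x)) : E →L[ℝ] E) hid'
    have h3 := congrArg (fun q : M => (mfderiv I 𝓘(ℝ, E) φ₀ q : E →L[ℝ] E) w) hφx
    exact (h.trans h2).trans h3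
  have hpull := extDeriv_pullback hη hτ (by simp)
  have key : extDerivOneForm I θ x ![u, v] = extDeriv η (φ₀ x)
      ![mfderiv I 𝓘(ℝ, E) φ₀ x u, mfderiv I 𝓘(ℝ, E) φ₀ x v] := by
    have hself (w : TangentSpace I x) : (mfderiv I 𝓘(ℝ, E) φ x w : E) = w :=
      congrArg (fun T : E →L[ℝ] E => T w) (mfderiv_extChartAt_self (I := I) (x := x))
    have hvec : (fun i => mfderiv I 𝓘(ℝ, E) φ x (![u, v] i) : Fin 2 → E) = ![u, v] := by
      funext i
      exact hself _
    have hvec' : (fun i => fderiv ℝ τ (φ x) ((![u, v] : Fin 2 → E) i)) =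
        ![mfderiv I 𝓘(ℝ, E) φ₀ x u, mfderiv I 𝓘(ℝ, E) φ₀ x v] := by
      funext i
      fin_cases i
      exacts [hd u, hd v]
    calc extDerivOneForm I θ x ![u, v]
        = extDeriv (fun y => ContinuousAlternatingMap.ofSubsingleton ℝ E ℝ (0 : Fin 1)
            (chartOneForm θ x y)) (φ x)
            (fun i => mfderiv I 𝓘(ℝ, E) φ x (![u, v] i) : Fin 2 → E) := rfl
      _ = (extDeriv η (τ (φ x))).compContinuousLinearMap (fderiv ℝ τ (φ x)) ![u, v] := by
        rw [hvec, heq.extDeriv_eq, hpull]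
        rfl
      _ = extDeriv η (τ (φ x)) (fun i => fderiv ℝ τ (φ x) ((![u, v] : Fin 2 → E) i)) := rfl
      _ = _ := by
        rw [hvec', hτx]
        rfl
  rw [key]
  exact extDeriv_ofSubsingleton_apply hθ _ _

end Charts

/-! ### The charts of `T¹ₖQ` -/

namespace KSymplectic

variable {n k : ℕ} {Q : Type*} [TopologicalSpace Q] [ChartedSpace (EuclideanSpace ℝ (Fin n)) Q]
  [IsManifold (𝓡 n) ∞ Q]

variable (n k) in
/-- The model vector space of `T¹ₖQ`. -/
abbrev Model : Type := EuclideanSpace ℝ (Fin n) × (Fin k → EuclideanSpace ℝ (Fin n))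

/-- The derivative at `x` of the chart of `T¹ₖQ` at `x₀`. -/
def dchart (x₀ x : T n k Q) : TS x →L[ℝ] Model n k :=
  mfderiv (J n k) 𝓘(ℝ, Model n k) (extChartAt (J n k) x₀) x

/-- The derivative at `q` of the chart of `Q` at `q₀`. -/
def dchartBase (q₀ q : Q) : TangentSpace (𝓡 n) q →L[ℝ] EuclideanSpace ℝ (Fin n) :=
  mfderiv (𝓡 n) 𝓘(ℝ, EuclideanSpace ℝ (Fin n)) (extChartAt (𝓡 n) q₀) q

theorem mem_extChartAt_source_iff {x₀ x : T n k Q} :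
    x ∈ (extChartAt (J n k) x₀).source ↔
      x.proj ∈ (chartAt (EuclideanSpace ℝ (Fin n)) x₀.proj).source := by
  have hb : (trivializationAt (Fin k → EuclideanSpace ℝ (Fin n))
      (KTangentSpace (𝓡 n) k : Q → Type _) x₀.proj).baseSet =
      (chartAt (EuclideanSpace ℝ (Fin n)) x₀.proj).source := rfl
  rw [FiberBundle.extChartAt]
  simp only [mfld_simps]
  rw [Trivialization.mem_source, hb]
  constructor
  · exact fun h => h.1
  · intro h
    refine ⟨h, ?_⟩
    rwa [Trivialization.coe_fst' _ (hb ▸ h)]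

theorem extChartAt_apply_fst {x₀ x : T n k Q} (hx : x ∈ (extChartAt (J n k) x₀).source) :
    (extChartAt (J n k) x₀ x).1 = extChartAt (𝓡 n) x₀.proj x.proj := by
  rw [mem_extChartAt_source_iff] at hx
  rw [FiberBundle.extChartAt]
  have h : (trivializationAt (Fin k → EuclideanSpace ℝ (Fin n))
      (KTangentSpace (𝓡 n) k : Q → Type _) x₀.proj x).1 = x.proj := Trivialization.coe_fst' _ hx
  exact congrArg (extChartAt (𝓡 n) x₀.proj) h

/-- The trivialization acts on each summand as that of TQ, which is the derivative of the base
chart. The charts are therefore linear on fibres. -/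
theorem extChartAt_fibreIncl {x₀ : T n k Q} {q : Q}
    (hq : q ∈ (chartAt (EuclideanSpace ℝ (Fin n)) x₀.proj).source)
    (w : Fin k → EuclideanSpace ℝ (Fin n)) :
    extChartAt (J n k) x₀ (fibreIncl q w) =
      (extChartAt (𝓡 n) x₀.proj q, fun a => dchartBase x₀.proj q (w a)) := by
  refine Prod.ext (extChartAt_apply_fst (mem_extChartAt_source_iff.2 hq)) ?_
  funext a
  rw [dchartBase, ← TangentBundle.continuousLinearMapAt_trivializationAt hq,
    TangentBundle.continuousLinearMapAt_trivializationAt_eq_core hq, FiberBundle.extChartAt]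
  rfl

theorem injective_dchart {x₀ x : T n k Q} (hx : x ∈ (extChartAt (J n k) x₀).source) :
    Function.Injective (dchart x₀ x) :=
  Function.LeftInverse.injective fun v => mfderiv_extChartAt_symm_apply_mfderiv hx v

theorem surjective_dchart {x₀ x : T n k Q} (hx : x ∈ (extChartAt (J n k) x₀).source) :
    Function.Surjective (dchart x₀ x) :=
  Function.RightInverse.surjective fun v => mfderiv_extChartAt_apply_mfderiv_symm hx v

theorem injective_dchartBase {q₀ q : Q} (hq : q ∈ (extChartAt (𝓡 n) q₀).source) :
    Function.Injective (dchartBase (n := n) q₀ q) :=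
  Function.LeftInverse.injective fun v => mfderiv_extChartAt_symm_apply_mfderiv hq v

theorem dchart_apply_fst {x₀ x : T n k Q} (hx : x ∈ (extChartAt (J n k) x₀).source) (z : TS x) :
    (dchart x₀ x z).1 = dchartBase x₀.proj x.proj (dπ x z) := by
  have hx' := mem_extChartAt_source_iff.1 hx
  have heq : (Prod.fst : Model n k → _) ∘ extChartAt (J n k) x₀ =ᶠ[𝓝 x]
      extChartAt (𝓡 n) x₀.proj ∘ fun y : T n k Q => y.proj := by
    filter_upwards [(isOpen_extChartAt_source x₀).mem_nhds hx] with y hy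
    exact extChartAt_apply_fst hy
  have h := heq.mfderiv_eq (I := J n k) (I' := 𝓘(ℝ, EuclideanSpace ℝ (Fin n)))
  rw [mfderiv_comp (I' := 𝓘(ℝ, Model n k)) x
    differentiableAt_fst.mdifferentiableAt (mdifferentiableAt_extChartAt
      (by rwa [extChartAt_source] at hx)),
    mfderiv_comp (I' := 𝓡 n) x (mdifferentiableAt_extChartAt hx')
      ((contMDiff_proj _).mdifferentiableAt one_ne_zero),
    mfderiv_eq_fderiv, fderiv_fst] at h
  exact congrArg (fun A : Model n k →L[ℝ] EuclideanSpace ℝ (Fin n) => A z) h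

theorem dπ_eq_zero_iff {x₀ x : T n k Q} (hx : x ∈ (extChartAt (J n k) x₀).source) (z : TS x) :
    dπ x z = 0 ↔ (dchart x₀ x z).1 = 0 := by
  rw [dchart_apply_fst hx]
  have hx' := mem_extChartAt_source_iff.1 hx
  rw [← extChartAt_source (𝓡 n)] at hx'
  exact ⟨fun h => by rw [h, map_zero],
    fun h => injective_dchartBase hx' (h.trans (map_zero (dchartBase x₀.proj x.proj)).symm)⟩

theorem mdifferentiable_fibreIncl (q : Q) :
    MDifferentiable 𝓘(ℝ, Fin k → EuclideanSpace ℝ (Fin n)) (J n k)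
      (fibreIncl q : (Fin k → EuclideanSpace ℝ (Fin n)) → T n k Q) := by
  intro w
  refine ContMDiffAt.mdifferentiableAt (n := 1) ?_ one_ne_zero
  rw [contMDiffAt_totalSpace]
  refine ⟨contMDiffAt_const, ?_⟩
  let A : EuclideanSpace ℝ (Fin n) →L[ℝ] EuclideanSpace ℝ (Fin n) := dchartBase q q
  let B : (Fin k → EuclideanSpace ℝ (Fin n)) →L[ℝ] (Fin k → EuclideanSpace ℝ (Fin n)) :=
    ContinuousLinearMap.piMap fun _ => A
  refine B.contMDiff.contMDiffAt.congr_of_eventuallyEq (Filter.Eventually.of_forall fun w' => ?_)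
  have h := extChartAt_fibreIncl (x₀ := fibreIncl q w) (mem_chart_source _ q) w'
  rw [FiberBundle.extChartAt] at h
  exact (Prod.ext_iff.1 h).2

theorem dchart_fibreDeriv {x₀ x : T n k Q} (hx : x ∈ (extChartAt (J n k) x₀).source)
    (w : Fin k → TangentSpace (𝓡 n) x.proj) :
    dchart x₀ x (fibreDeriv x w) = (0, fun a => dchartBase x₀.proj x.proj (w a)) := by
  have hx' := mem_extChartAt_source_iff.1 hx
  let A : EuclideanSpace ℝ (Fin n) →L[ℝ] EuclideanSpace ℝ (Fin n) := dchartBase x₀.proj x.proj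
  let B : (Fin k → EuclideanSpace ℝ (Fin n)) →L[ℝ] (Fin k → EuclideanSpace ℝ (Fin n)) :=
    ContinuousLinearMap.piMap fun _ => A
  have heq : extChartAt (J n k) x₀ ∘ fibreIncl x.proj =
      fun w => (extChartAt (𝓡 n) x₀.proj x.proj, B w) :=
    funext fun w => extChartAt_fibreIncl hx' w
  let v : Fin k → EuclideanSpace ℝ (Fin n) := vel x
  have h := mfderiv_comp (I' := J n k) (I'' := 𝓘(ℝ, Model n k))
    (I := 𝓘(ℝ, Fin k → EuclideanSpace ℝ (Fin n))) v
    (g := extChartAt (J n k) x₀) (f := fibreIncl x.proj)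
    (mdifferentiableAt_extChartAt (by rwa [extChartAt_source] at hx))
    (mdifferentiable_fibreIncl x.proj v)
  have hfd : HasFDerivAt (fun w => (extChartAt (𝓡 n) x₀.proj x.proj, B w))
      ((0 : (Fin k → EuclideanSpace ℝ (Fin n)) →L[ℝ] EuclideanSpace ℝ (Fin n)).prod B) v :=
    (hasFDerivAt_const _ _).prodMk B.hasFDerivAt
  rw [heq, mfderiv_eq_fderiv, hfd.fderiv] at h
  exact (congrArg (fun A : (Fin k → EuclideanSpace ℝ (Fin n)) →L[ℝ] Model n k => A w) h).symm

theorem injective_fibreDeriv (x : T n k Q) : Function.Injective (fibreDeriv x) := by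
  intro w w' h
  have hx := mem_extChartAt_source (I := J n k) x
  have h' := congrArg (dchart x x) h
  rw [dchart_fibreDeriv hx, dchart_fibreDeriv hx] at h'
  funext a
  exact injective_dchartBase (mem_extChartAt_source x.proj) (congrFun (Prod.ext_iff.1 h').2 a)

/-- J^α has constant coefficients in a bundle chart, so the coefficients of θ^α_L are first
derivatives of L and hence smooth. -/
theorem dchart_vendo {x₀ x : T n k Q} (hx : x ∈ (extChartAt (J n k) x₀).source) (α : Fin k)
    (z : TS x) : dchart x₀ x (vendo α x z) = (0, Pi.single α (dchart x₀ x z).1) := by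
  rw [dchart_apply_fst hx]
  change dchart x₀ x (fibreDeriv x (Pi.single α (dπ x z))) = _
  rw [dchart_fibreDeriv hx]
  congr 1
  funext a
  by_cases h : a = α
  · subst h; simp
  · simp [h]

end KSymplectic

/-! ### Common kernels of bilinear forms -/

section BilinKer

variable {E : Type*} [NormedAddCommGroup E] [NormedSpace ℝ E] {ι : Type*}

/-- The vectors `z` with `B i z v = 0` for all `i` and all `v ∈ N`. -/
def bilinKer (B : ι → E →L[ℝ] E →L[ℝ] ℝ) (N : Submodule ℝ E) : Submodule ℝ E where
  carrier := {z | ∀ i, ∀ v ∈ N, B i z v = 0}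
  add_mem' ha hb i v hv := by rw [map_add, add_apply, ha i v hv, hb i v hv, add_zero]
  zero_mem' i v _ := by rw [map_zero, zero_apply]
  smul_mem' c z hz i v hv := by rw [map_smul, smul_apply, hz i v hv, smul_zero]

variable [FiniteDimensional ℝ E]

theorem ContDiffOn.sub_flip {g : E → E →L[ℝ] E →L[ℝ] ℝ} {s : Set E} (hg : ContDiffOn ℝ ∞ g s) :
    ContDiffOn ℝ ∞ (fun y => g y - (g y).flip) s := by
  refine hg.sub ?_
  rw [contDiffOn_clm_apply]
  intro u
  rw [contDiffOn_clm_apply]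
  intro v
  exact (hg.clm_apply contDiffOn_const).clm_apply contDiffOn_const

/-- Where the common kernel has constant dimension, its vectors extend to smooth local sections. -/
theorem exists_contDiffOn_mem_bilinKer [Fintype ι]
    {B : ι → E → E →L[ℝ] E →L[ℝ] ℝ} {N : Submodule ℝ E} {s : Set E} (hs : IsOpen s)
    (hB : ∀ i, ContDiffOn ℝ ∞ (B i) s) {y₀ : E} (hy₀ : y₀ ∈ s)
    (hrank : ∀ y ∈ s, Module.finrank ℝ (bilinKer (fun i => B i y) N) =
      Module.finrank ℝ (bilinKer (fun i => B i y₀) N))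
    {z₀ : E} (hz₀ : z₀ ∈ bilinKer (fun i => B i y₀) N) :
    ∃ t : Set E, IsOpen t ∧ t ⊆ s ∧ y₀ ∈ t ∧ ∃ z : E → E, ContDiffOn ℝ ∞ z t ∧ z y₀ = z₀ ∧
      ∀ y ∈ t, z y ∈ bilinKer (fun i => B i y) N := by
  obtain ⟨p', hp'⟩ := N.subtype.exists_leftInverse_of_injective N.ker_subtype
  let p : E →L[ℝ] E := (N.subtype ∘ₗ p').toContinuousLinearMap
  have hpN (v : E) : p v ∈ N := (p' v).2
  have hp (v : E) (hv : v ∈ N) : p v = v := congrArg Subtype.val (LinearMap.congr_fun hp' ⟨v, hv⟩)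
  -- All conditions are gathered in one linear map; restriction of the second argument to `N` is
  -- expressed by composing with the projection `p` onto `N`.
  let A : E → E →L[ℝ] ι → E →L[ℝ] ℝ := fun y =>
    ContinuousLinearMap.pi fun i => ((ContinuousLinearMap.compL ℝ E E ℝ).flip p).comp (B i y)
  have hA : ContDiffOn ℝ ∞ A s := by
    rw [contDiffOn_clm_apply]
    intro z
    rw [contDiffOn_pi]
    intro i
    exact ((hB i).clm_apply contDiffOn_const).clm_comp contDiffOn_const
  have hker (y : E) : (A y : E →ₗ[ℝ] ι → E →L[ℝ] ℝ).ker = bilinKer (fun i => B i y) N := by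
    ext z
    refine ⟨fun h i v hv => ?_, fun h => ?_⟩
    · have := congrArg (fun f : ι → E →L[ℝ] ℝ => f i v) h
      rw [← hp v hv]
      exact this
    · refine funext fun i => ContinuousLinearMap.ext fun v => h i (p v) (hpN v)
  obtain ⟨t, ht, hts, hyt, z, hz, hz₀', hzker⟩ := exists_contDiffOn_mem_ker hs hA hy₀
    (fun y hy => by rw [hker, hker]; exact hrank y hy) (show z₀ ∈ LinearMap.ker _ by rwa [hker])
  exact ⟨t, ht, hts, hyt, z, hz, hz₀', fun y hy => hker y ▸ hzker y hy⟩

end BilinKer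

namespace KSymplectic

variable {n k : ℕ} {Q : Type*} [TopologicalSpace Q] [ChartedSpace (EuclideanSpace ℝ (Fin n)) Q]
  [IsManifold (𝓡 n) ∞ Q]

/-! ### The Cartan forms in charts -/

theorem contDiffOn_comp_extChartAt_symm {L : T n k Q → ℝ} (hL : ContMDiff (J n k) 𝓘(ℝ, ℝ) ∞ L)
    (x₀ : T n k Q) :
    ContDiffOn ℝ ∞ (L ∘ (extChartAt (J n k) x₀).symm) (extChartAt (J n k) x₀).target :=
  (hL.comp_contMDiffOn (contMDiffOn_extChartAt_symm x₀)).contDiffOn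

theorem dfun_apply {L : T n k Q → ℝ} (hL : ContMDiff (J n k) 𝓘(ℝ, ℝ) ∞ L) {x₀ x : T n k Q}
    (hx : x ∈ (extChartAt (J n k) x₀).source) (z : TS x) :
    dfun L x z = fderiv ℝ (L ∘ (extChartAt (J n k) x₀).symm) (extChartAt (J n k) x₀ x)
      (dchart x₀ x z) := by
  have heq : L =ᶠ[𝓝 x] (L ∘ (extChartAt (J n k) x₀).symm) ∘ extChartAt (J n k) x₀ := by
    filter_upwards [(isOpen_extChartAt_source x₀).mem_nhds hx] with y hy
    exact congrArg L ((extChartAt (J n k) x₀).left_inv hy).symm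
  have hy := (extChartAt (J n k) x₀).map_source hx
  have hd : DifferentiableAt ℝ (L ∘ (extChartAt (J n k) x₀).symm) (extChartAt (J n k) x₀ x) :=
    ((contDiffOn_comp_extChartAt_symm hL x₀).contDiffAt
      ((isOpen_extChartAt_target x₀).mem_nhds hy)).differentiableAt (by simp)
  have h := heq.mfderiv_eq (I := J n k) (I' := 𝓘(ℝ, ℝ))
  rw [mfderiv_comp (I' := 𝓘(ℝ, Model n k)) x hd.mdifferentiableAt
    (mdifferentiableAt_extChartAt (by rwa [extChartAt_source] at hx)), mfderiv_eq_fderiv] at h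
  exact congrArg (fun A : Model n k →L[ℝ] ℝ => A z) h

variable (n k) in
/-- The vertical endomorphism `J^α` of the model space. -/
def modelVendo (α : Fin k) : Model n k →L[ℝ] Model n k :=
  (ContinuousLinearMap.inr ℝ _ _).comp
    ((ContinuousLinearMap.single ℝ (fun _ : Fin k => EuclideanSpace ℝ (Fin n)) α).comp
      (ContinuousLinearMap.fst ℝ _ _))

theorem contDiffOn_chartOneForm_cartanOne {L : T n k Q → ℝ}
    (hL : ContMDiff (J n k) 𝓘(ℝ, ℝ) ∞ L) (x₀ : T n k Q) (α : Fin k) :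
    ContDiffOn ℝ ∞ (chartOneForm (cartanOne L α) x₀) (extChartAt (J n k) x₀).target := by
  have h1 : ContDiffOn ℝ ∞ (fderiv ℝ (L ∘ (extChartAt (J n k) x₀).symm))
      (extChartAt (J n k) x₀).target :=
    (contDiffOn_comp_extChartAt_symm hL x₀).fderiv_of_isOpen (isOpen_extChartAt_target x₀) le_rfl
  refine (h1.clm_comp (contDiffOn_const (c := modelVendo n k α))).congr fun y hy => ?_
  obtain ⟨x, hx, rfl⟩ : ∃ x ∈ (extChartAt (J n k) x₀).source, extChartAt (J n k) x₀ x = y :=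
    ⟨_, (extChartAt (J n k) x₀).map_target hy, (extChartAt (J n k) x₀).right_inv hy⟩
  refine ContinuousLinearMap.ext fun u => ?_
  obtain ⟨z, rfl⟩ := surjective_dchart hx u
  refine (chartOneForm_apply_mfderiv (cartanOne L α) hx z).trans ?_
  refine (dfun_apply hL hx (vendo α x z)).trans ?_
  rw [dchart_vendo hx]
  rfl

/-- The Cartan 2-forms in the chart at `x₀`, with the arguments exchanged. -/
def chartCartanTwo (L : T n k Q → ℝ) (x₀ : T n k Q) (α : Fin k) (y : Model n k) :
    Model n k →L[ℝ] Model n k →L[ℝ] ℝ :=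
  fderiv ℝ (chartOneForm (cartanOne L α) x₀) y -
    (fderiv ℝ (chartOneForm (cartanOne L α) x₀) y).flip

theorem contDiffOn_chartCartanTwo {L : T n k Q → ℝ}
    (hL : ContMDiff (J n k) 𝓘(ℝ, ℝ) ∞ L) (x₀ : T n k Q) (α : Fin k) :
    ContDiffOn ℝ ∞ (chartCartanTwo L x₀ α) (extChartAt (J n k) x₀).target :=
  ((contDiffOn_chartOneForm_cartanOne hL x₀ α).fderiv_of_isOpen
    (isOpen_extChartAt_target x₀) le_rfl).sub_flip

/-- The sign in ω = −dθ is absorbed by exchanging the arguments, which also puts `z` in the slot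
that `bilinKer` tests. -/
theorem cartanTwo_apply {L : T n k Q → ℝ} (hL : ContMDiff (J n k) 𝓘(ℝ, ℝ) ∞ L)
    {x₀ x : T n k Q} (hx : x ∈ (extChartAt (J n k) x₀).source) (α : Fin k) (u z : TS x) :
    cartanTwo L α x ![u, z] =
      chartCartanTwo L x₀ α (extChartAt (J n k) x₀ x) (dchart x₀ x z) (dchart x₀ x u) := by
  have hd : DifferentiableAt ℝ (chartOneForm (cartanOne L α) x₀) (extChartAt (J n k) x₀ x) :=
    ((contDiffOn_chartOneForm_cartanOne hL x₀ α).contDiffAt ((isOpen_extChartAt_target x₀).mem_nhds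
      ((extChartAt (J n k) x₀).map_source hx))).differentiableAt (by simp)
  change -extDerivOneForm (J n k) (cartanOne L α) x ![u, z] = _
  rw [extDerivOneForm_apply _ hx hd]
  exact neg_sub _ _

theorem kOmega_apply (L : T n k Q → ℝ) (x : T n k Q) (X : Fin k → TS x) (z : TS x) :
    kOmega L x X z = ∑ α, cartanTwo L α x ![X α, z] := by
  simp [kOmega, LinearMap.sum_apply, contract]

theorem cartanTwo_swap (L : T n k Q → ℝ) (α : Fin k) (x : T n k Q) (u z : TS x) :
    cartanTwo L α x ![u, z] = -cartanTwo L α x ![z, u] := by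
  have h := (cartanTwo L α x).map_swap ![z, u] (i := 0) (j := 1) (by decide)
  refine Eq.trans (congrArg (cartanTwo L α x) ?_) h
  funext i
  fin_cases i <;> rfl

/-- `Ω_L` at the point `x`, as a linear map. -/
def kOmegaLinear (L : T n k Q → ℝ) (x : T n k Q) :
    (Fin k → TS x) →ₗ[ℝ] Module.Dual ℝ (TS x) where
  toFun := kOmega L x
  map_add' X Y := LinearMap.ext fun z => by
    simp only [LinearMap.add_apply, kOmega_apply, ← Finset.sum_add_distrib, Pi.add_apply]
    refine Finset.sum_congr rfl fun α _ => ?_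
    -- Antisymmetry moves the k-vector into the slot in which `contract` is linear.
    simp only [cartanTwo_swap L α x _ z]
    rw [← neg_add]
    exact congrArg Neg.neg ((contract (cartanTwo L α x) z).map_add _ _)
  map_smul' c X := LinearMap.ext fun z => by
    simp only [LinearMap.smul_apply, kOmega_apply, Finset.smul_sum, Pi.smul_apply, RingHom.id_apply]
    refine Finset.sum_congr rfl fun α _ => ?_
    simp only [cartanTwo_swap L α x _ z]
    rw [smul_neg]
    exact congrArg Neg.neg ((contract (cartanTwo L α x) z).map_smul _ _)

theorem kOmega_sub (L : T n k Q → ℝ) (x : T n k Q) (X Y : Fin k → TS x) :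
    kOmega L x (X - Y) = kOmega L x X - kOmega L x Y := (kOmegaLinear L x).map_sub X Y

theorem kOmega_add (L : T n k Q → ℝ) (x : T n k Q) (X Y : Fin k → TS x) :
    kOmega L x (X + Y) = kOmega L x X + kOmega L x Y := (kOmegaLinear L x).map_add X Y

/-! ### Annihilators of distributions that are constant in charts -/

theorem mem_annihilatorAt {L : T n k Q → ℝ} {x : T n k Q} {S : Set (Fin k → TS x)} {z : TS x} :
    z ∈ annihilatorAt L x S ↔ ∀ Y ∈ S, kOmega L x Y z = 0 := by
  simp [annihilatorAt]

/-- A distribution that is a constant subspace of the model space in each preferred chart. -/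
def IsChartConstant (P : ∀ x : T n k Q, Submodule ℝ (TS x)) : Prop :=
  ∀ x₀ : T n k Q, ∃ N : Submodule ℝ (Model n k), ∀ x ∈ (extChartAt (J n k) x₀).source,
    ∀ v : TS x, v ∈ P x ↔ dchart x₀ x v ∈ N

/-- The whole tangent space yields [𝔛ᵏ]^⊥ and 𝔎, the vertical subspace yields 𝔐; both cases are
treated together below. -/
theorem isChartConstant_top : IsChartConstant fun x : T n k Q => (⊤ : Submodule ℝ (TS x)) :=
  fun _ => ⟨⊤, fun _ _ _ => by simp⟩

theorem isChartConstant_ker_dπ :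
    IsChartConstant fun x : T n k Q => (dπ x : TS x →ₗ[ℝ] TangentSpace (𝓡 n) x.proj).ker :=
  fun _ => ⟨(LinearMap.fst ℝ _ _).ker, fun _ hx v => dπ_eq_zero_iff hx v⟩

/-- The annihilator at `x` of the `k`-vectors with components in `P`. -/
abbrev annAt (L : T n k Q → ℝ) (P : ∀ x : T n k Q, Submodule ℝ (TS x)) (x : T n k Q) :
    Submodule ℝ (TS x) :=
  annihilatorAt L x {V | ∀ α, V α ∈ P x}

/-- The annihilator of the `k`-vector fields with components in `P`. -/
abbrev annFields (L : T n k Q → ℝ) (P : ∀ x : T n k Q, Submodule ℝ (TS x)) :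
    Set (VField (J n k) (T n k Q)) :=
  annihilator L {V | ∀ α x, V α x ∈ P x}

theorem mem_annAt_iff {L : T n k Q → ℝ} (hL : ContMDiff (J n k) 𝓘(ℝ, ℝ) ∞ L)
    {P : ∀ x : T n k Q, Submodule ℝ (TS x)} {x₀ : T n k Q} {N : Submodule ℝ (Model n k)}
    (hN : ∀ x ∈ (extChartAt (J n k) x₀).source, ∀ v : TS x, v ∈ P x ↔ dchart x₀ x v ∈ N)
    {x : T n k Q} (hx : x ∈ (extChartAt (J n k) x₀).source) (z : TS x) :
    z ∈ annAt L P x ↔ dchart x₀ x z ∈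
      bilinKer (fun α => chartCartanTwo L x₀ α (extChartAt (J n k) x₀ x)) N := by
  rw [mem_annihilatorAt]
  constructor
  · intro h α v hv
    obtain ⟨u, rfl⟩ := surjective_dchart hx v
    have hu : u ∈ P x := (hN x hx u).2 hv
    -- A k-vector with a single nonzero component isolates one form from the sum over α.
    have := h (Pi.single α u) fun β => by
      by_cases hβ : β = α
      · subst hβ; rwa [Pi.single_eq_same]
      · rw [Pi.single_eq_of_ne hβ]; exact (P x).zero_mem
    rw [kOmega_apply, Finset.sum_eq_single α, Pi.single_eq_same, cartanTwo_apply hL hx] at this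
    · exact this
    · intro β _ hβ
      rw [Pi.single_eq_of_ne hβ]
      exact (cartanTwo L β x).map_coord_zero 0 rfl
    · exact fun hα => absurd (Finset.mem_univ α) hα
  · intro h V hV
    rw [kOmega_apply]
    refine Finset.sum_eq_zero fun α _ => ?_
    rw [cartanTwo_apply hL hx]
    exact h α _ ((hN x hx _).1 (hV α))

theorem finrank_annAt {L : T n k Q → ℝ} (hL : ContMDiff (J n k) 𝓘(ℝ, ℝ) ∞ L)
    {P : ∀ x : T n k Q, Submodule ℝ (TS x)} {x₀ : T n k Q} {N : Submodule ℝ (Model n k)}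
    (hN : ∀ x ∈ (extChartAt (J n k) x₀).source, ∀ v : TS x, v ∈ P x ↔ dchart x₀ x v ∈ N)
    {x : T n k Q} (hx : x ∈ (extChartAt (J n k) x₀).source) :
    Module.finrank ℝ (annAt L P x) = Module.finrank ℝ
      (bilinKer (fun α => chartCartanTwo L x₀ α (extChartAt (J n k) x₀ x)) N) := by
  let e : TS x ≃ₗ[ℝ] Model n k := LinearEquiv.ofBijective (dchart x₀ x : TS x →ₗ[ℝ] Model n k)
    ⟨injective_dchart hx, surjective_dchart hx⟩
  have h : annAt L P x = Submodule.comap (e : TS x →ₗ[ℝ] Model n k)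
      (bilinKer (fun α => chartCartanTwo L x₀ α (extChartAt (J n k) x₀ x)) N) :=
    Submodule.ext fun z => mem_annAt_iff hL hN hx z
  rw [h, ← LinearEquiv.finrank_map_eq e, Submodule.map_comap_eq_of_surjective e.surjective]

/-- The annihilator is the dual coannihilator of the image `W` of Ω_L, and `W` is its own double
annihilator in finite dimension. No rank condition is involved. -/
theorem forall_mem_annAt_iff_exists (L : T n k Q → ℝ) (P : ∀ x : T n k Q, Submodule ℝ (TS x))
    {x : T n k Q} (f : TS x →ₗ[ℝ] ℝ) :
    (∀ z ∈ annAt L P x, f z = 0) ↔ ∃ V : Fin k → TS x, (∀ α, V α ∈ P x) ∧ kOmega L x V = f := by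
  have : FiniteDimensional ℝ (TS x) := inferInstanceAs (FiniteDimensional ℝ (Model n k))
  refine ⟨fun h => ?_, fun ⟨V, hV, hVf⟩ z hz => hVf ▸ mem_annihilatorAt.1 hz V hV⟩
  let W : Submodule ℝ (Module.Dual ℝ (TS x)) :=
    (Submodule.pi univ fun _ : Fin k => P x).map (kOmegaLinear L x)
  have hf : f ∈ W.dualCoannihilator.dualAnnihilator := by
    rw [Submodule.mem_dualAnnihilator]
    intro z hz
    rw [Submodule.mem_dualCoannihilator] at hz
    exact h z (mem_annihilatorAt.2 fun Y hY => hz _ ⟨Y, fun α _ => hY α, rfl⟩)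
  rw [Subspace.dualCoannihilator_dualAnnihilator_eq] at hf
  obtain ⟨V, hV, hVf⟩ := hf
  exact ⟨V, fun α => hV α (mem_univ α), hVf⟩

/-! ### From vectors at a point to global vector fields -/

variable [T2Space Q]

theorem t2Space : T2Space (T n k Q) := FiberBundle.t2Space_totalSpace

/-- Fields with constant coefficients in the chart stay in `P`, and so do their multiples by a bump
function. -/
theorem IsChartConstant.exists_kVField {P : ∀ x : T n k Q, Submodule ℝ (TS x)}
    (hP : IsChartConstant P) (x₀ : T n k Q) (Y : Fin k → TS x₀) (hY : ∀ α, Y α ∈ P x₀) :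
    ∃ V : KVField (J n k) (T n k Q) k, (∀ α, V α x₀ = Y α) ∧ ∀ α x, V α x ∈ P x := by
  have := t2Space (n := n) (k := k) (Q := Q)
  obtain ⟨N, hN⟩ := hP x₀
  have hx₀ := mem_extChartAt_source (I := J n k) x₀
  choose V ψ hψ hV0 hV using fun α => exists_vField_mfderiv_extChartAt_eq (J n k) x₀
    (chartAt _ x₀).open_source (mem_chart_source _ x₀) subset_rfl
    (contMDiffOn_const (c := dchart x₀ x₀ (Y α)))
  refine ⟨V, fun α => injective_dchart hx₀ ?_, fun α x => ?_⟩
  · refine (hV α x₀ (mem_chart_source _ x₀)).trans ?_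
    rw [hψ, one_smul]
  · by_cases hx : x ∈ (chartAt (ModelProd (EuclideanSpace ℝ (Fin n))
      (Fin k → EuclideanSpace ℝ (Fin n))) x₀).source
    · rw [hN x (by rwa [extChartAt_source])]
      exact (hV α x hx) ▸ N.smul_mem (ψ α x) ((hN x₀ hx₀ _).1 (hY α))
    · rw [hV0 α x hx]
      exact (P x).zero_mem

theorem IsChartConstant.mem_annFields_iff {P : ∀ x : T n k Q, Submodule ℝ (TS x)}
    (hP : IsChartConstant P) (L : T n k Q → ℝ) (Z : VField (J n k) (T n k Q)) :
    Z ∈ annFields L P ↔ ∀ x, Z x ∈ annAt L P x := by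
  refine ⟨fun h x => mem_annihilatorAt.2 fun Y hY => ?_,
    fun h Y hY x => mem_annihilatorAt.1 (h x) _ fun α => hY α x⟩
  obtain ⟨V, hV, hVP⟩ := hP.exists_kVField x Y hY
  have := h V hVP x
  rwa [funext hV] at this

/-- This is where local constancy of the rank is needed: a vector of the annihilator may have no
smooth extension where the dimension jumps. -/
theorem IsChartConstant.exists_mem_annFields {L : T n k Q → ℝ}
    (hL : ContMDiff (J n k) 𝓘(ℝ, ℝ) ∞ L) {P : ∀ x : T n k Q, Submodule ℝ (TS x)}
    (hP : IsChartConstant P) (hrank : LocConstRank (annAt L P)) {x₀ : T n k Q} {z : TS x₀}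
    (hz : z ∈ annAt L P x₀) : ∃ Z ∈ annFields L P, Z x₀ = z := by
  have := t2Space (n := n) (k := k) (Q := Q)
  obtain ⟨N, hN⟩ := hP x₀
  let φ := extChartAt (J n k) x₀
  have hx₀ : x₀ ∈ φ.source := mem_extChartAt_source (I := J n k) x₀
  let s := φ.target ∩ φ.symm ⁻¹' {x | Module.finrank ℝ (annAt L P x) =
    Module.finrank ℝ (annAt L P x₀)}
  have hs : IsOpen s := (continuousOn_extChartAt_symm x₀).isOpen_inter_preimage
    (isOpen_extChartAt_target x₀) (hrank.isOpen_fiber _)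
  have hinv : φ.symm (φ x₀) = x₀ := φ.left_inv hx₀
  have hy₀ : φ x₀ ∈ s := ⟨φ.map_source hx₀, by rw [mem_preimage, hinv]; rfl⟩
  obtain ⟨t, ht, hts, hyt, ζ, hζ, hζ₀, hζker⟩ := exists_contDiffOn_mem_bilinKer hs
    (fun α => (contDiffOn_chartCartanTwo hL x₀ α).mono inter_subset_left) hy₀ (fun y hy => by
      have h1 := finrank_annAt hL hN (φ.map_target hy.1)
      rw [φ.right_inv hy.1] at h1
      rw [← h1, ← finrank_annAt hL hN hx₀]
      exact hy.2) ((mem_annAt_iff hL hN hx₀ z).1 hz)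
  have hsub : φ.source ∩ φ ⁻¹' t ⊆ (chartAt (ModelProd (EuclideanSpace ℝ (Fin n))
      (Fin k → EuclideanSpace ℝ (Fin n))) x₀).source := by
    rw [← extChartAt_source (J n k)]
    exact inter_subset_left
  have hf : ContMDiffOn (J n k) 𝓘(ℝ, Model n k) ∞ (ζ ∘ φ) (φ.source ∩ φ ⁻¹' t) :=
    hζ.contMDiffOn.comp (contMDiffOn_extChartAt.mono hsub) fun _ hx => hx.2
  obtain ⟨Z, ψ, hψ, hZ0, hZ⟩ := exists_vField_mfderiv_extChartAt_eq (J n k) x₀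
    ((continuousOn_extChartAt x₀).isOpen_inter_preimage (isOpen_extChartAt_source x₀) ht)
    ⟨hx₀, hyt⟩ hsub hf
  refine ⟨Z, (hP.mem_annFields_iff L Z).2 fun x => ?_, injective_dchart hx₀ ?_⟩
  · by_cases hx : x ∈ φ.source ∩ φ ⁻¹' t
    · rw [mem_annAt_iff hL hN hx.1]
      exact (hZ x hx) ▸ Submodule.smul_mem _ (ψ x) (hζker _ hx.2)
    · rw [hZ0 x hx]
      exact Submodule.zero_mem _
  · refine (hZ x₀ ⟨hx₀, hyt⟩).trans ?_
    rw [hψ, one_smul]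
    exact hζ₀

theorem IsChartConstant.forall_mem_annAt_iff {L : T n k Q → ℝ}
    (hL : ContMDiff (J n k) 𝓘(ℝ, ℝ) ∞ L) {P : ∀ x : T n k Q, Submodule ℝ (TS x)}
    (hP : IsChartConstant P) (hrank : LocConstRank (annAt L P)) {x : T n k Q}
    (f : TS x →ₗ[ℝ] ℝ) :
    (∀ z ∈ annAt L P x, f z = 0) ↔ ∀ Z ∈ annFields L P, f (Z x) = 0 := by
  refine ⟨fun h Z hZ => h _ ((hP.mem_annFields_iff L Z).1 hZ x), fun h z hz => ?_⟩
  obtain ⟨Z, hZ, rfl⟩ := hP.exists_mem_annFields hL hrank hz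
  exact h Z hZ

end KSymplectic

namespace KSymplectic

/-! ### The constraint submanifold -/

section Constraints

variable {n k : ℕ} {Q : Type*} [TopologicalSpace Q] [ChartedSpace (EuclideanSpace ℝ (Fin n)) Q]
  [IsManifold (𝓡 n) ∞ Q]

theorem sum_vlift (x : T n k Q) (u : Fin k → TangentSpace (𝓡 n) x.proj) :
    ∑ α, vlift α x (u α) = fibreDeriv x u := by
  have h : ∑ α, (Pi.single α (u α) : Fin k → TangentSpace (𝓡 n) x.proj) = u :=
    Finset.univ_sum_single u
  conv_rhs => rw [← h, map_sum]
  rfl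

/-- Both sides of the first equation are values of the injective `fibreDeriv x`, at (Tπ W_α) and at
(v_α). -/
theorem sum_vendo_eq_liouville_iff (x : T n k Q) (W : Fin k → TS x) :
    ∑ α, vendo α x (W α) = liouville x ↔ ∀ α, dπ x (W α) = vel x α := by
  have h1 : ∑ α, vendo α x (W α) = fibreDeriv x fun α => dπ x (W α) :=
    sum_vlift x fun α => dπ x (W α)
  rw [h1, liouville, sum_vlift, (injective_fibreDeriv x).eq_iff, funext_iff]

theorem mem_S₁_iff {L : T n k Q → ℝ} {X : ∀ x : T n k Q, Fin k → TS x}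
    (hX : ∀ x ∈ P₁ L, SolvesAt L x (X x)) {Γ : KVField (J n k) (T n k Q) k} (hΓ : IsSOPDE Γ)
    (x : T n k Q) :
    x ∈ S₁ L X ↔ ∃ V : Fin k → TS x, (∀ α, dπ x (V α) = 0) ∧ kOmega L x V = defect L Γ x := by
  constructor
  · rintro ⟨hx, Y, hY, hsum⟩
    have hW := (sum_vendo_eq_liouville_iff x fun α => X x α + Y α).1 hsum
    refine ⟨(fun α => Γ α x) - (X x + Y), fun α => ?_, ?_⟩
    · change dπ x (Γ α x - (X x α + Y α)) = 0
      rw [map_sub, hΓ x α, hW α, sub_self]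
    · rw [kOmega_sub, kOmega_add, hY, add_zero, hX x hx, defect]
  · rintro ⟨V, hV, hΩ⟩
    -- Γ − V is a solution at `x`, which gives `x ∈ P₁ L`; its difference from X is the required
    -- element of the kernel.
    have hW : SolvesAt L x ((fun α => Γ α x) - V) := by
      rw [SolvesAt, kOmega_sub, hΩ, defect, sub_sub_cancel]
    have hx : x ∈ P₁ L := ⟨_, hW⟩
    refine ⟨hx, (fun α => Γ α x) - V - X x, ?_, ?_⟩
    · rw [kOmega_sub, hW, hX x hx, sub_self]
    · rw [sum_vendo_eq_liouville_iff]
      intro α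
      have : X x α + ((fun α => Γ α x) - V - X x) α = Γ α x - V α := add_sub_cancel _ _
      rw [this, map_sub, hV α, hΓ x α, sub_zero]

theorem annAt_ker_dπ (L : T n k Q → ℝ) :
    annAt L (fun x => (dπ x : TS x →ₗ[ℝ] TangentSpace (𝓡 n) x.proj).ker) = 𝔐At L := rfl

theorem annFields_top (L : T n k Q → ℝ) : annFields L (fun _ => ⊤) = kPerp L := by
  simp [annFields, kPerp, ofPred_true]

theorem annAt_top (L : T n k Q → ℝ) : annAt L (fun _ => ⊤) = kPerpAt L := by
  funext x
  simp [annAt, kPerpAt, ofPred_true]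

theorem kPerp_subset_𝔐 (L : T n k Q → ℝ) : kPerp L ⊆ 𝔐 L := fun _ hZ Y _ => hZ Y (mem_univ Y)

theorem S₁_eq_annihilatorAt {L : T n k Q → ℝ} {X : ∀ x : T n k Q, Fin k → TS x}
    (hX : ∀ x ∈ P₁ L, SolvesAt L x (X x)) {Γ : KVField (J n k) (T n k Q) k} (hΓ : IsSOPDE Γ) :
    S₁ L X = {x | ∀ z ∈ 𝔐At L x, defect L Γ x z = 0} := by
  ext x
  rw [mem_S₁_iff hX hΓ]
  have h := forall_mem_annAt_iff_exists L
    (fun x => (dπ x : TS x →ₗ[ℝ] TangentSpace (𝓡 n) x.proj).ker) (defect L Γ x)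
  rw [annAt_ker_dπ] at h
  exact h.symm

theorem mem_P₁_iff (L : T n k Q → ℝ) (x : T n k Q) :
    x ∈ P₁ L ↔ ∀ z ∈ kPerpAt L x, dfun (energy L) x z = 0 := by
  have h := forall_mem_annAt_iff_exists L (fun _ => ⊤) (dfun (energy L) x : TS x →ₗ[ℝ] ℝ)
  rw [annAt_top] at h
  refine Iff.trans ?_ h.symm
  exact ⟨fun ⟨V, hV⟩ => ⟨V, fun _ => Submodule.mem_top, hV⟩, fun ⟨V, _, hV⟩ => ⟨V, hV⟩⟩

theorem defect_apply_of_mem_kPerp {L : T n k Q → ℝ} (Γ : KVField (J n k) (T n k Q) k)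
    {Z : VField (J n k) (T n k Q)} (hZ : Z ∈ kPerp L) (x : T n k Q) :
    defect L Γ x (Z x) = -dynConstraint L Z x := by
  rw [defect, LinearMap.sub_apply, hZ Γ (mem_univ Γ) x, zero_sub]
  rfl

theorem defect_apply_of_mem_P₁ {L : T n k Q → ℝ} {X : ∀ x : T n k Q, Fin k → TS x}
    (hX : ∀ x ∈ P₁ L, SolvesAt L x (X x)) (Γ : KVField (J n k) (T n k Q) k)
    (Z : VField (J n k) (T n k Q)) {x : T n k Q} (hx : x ∈ P₁ L) :
    defect L Γ x (Z x) = sopdeConstraint L Γ X Z x := by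
  rw [defect, ← hX x hx, ← kOmega_sub]
  rfl

theorem S₁_eq_annihilator [T2Space Q] {L : T n k Q → ℝ} (hL : ContMDiff (J n k) 𝓘(ℝ, ℝ) ∞ L)
    {X : ∀ x : T n k Q, Fin k → TS x} (hX : ∀ x ∈ P₁ L, SolvesAt L x (X x))
    {Γ : KVField (J n k) (T n k Q) k} (hΓ : IsSOPDE Γ) (hrank : LocConstRank (𝔐At L)) :
    S₁ L X = {x | ∀ Z ∈ 𝔐 L, defect L Γ x (Z x) = 0} := by
  rw [S₁_eq_annihilatorAt hX hΓ]
  ext x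
  exact isChartConstant_ker_dπ.forall_mem_annAt_iff hL hrank (defect L Γ x)

theorem P₁_eq_dynConstraint [T2Space Q] {L : T n k Q → ℝ}
    (hL : ContMDiff (J n k) 𝓘(ℝ, ℝ) ∞ L) (hrank : LocConstRank (kPerpAt L)) :
    P₁ L = {x | ∀ Z ∈ kPerp L, dynConstraint L Z x = 0} := by
  ext x
  rw [mem_P₁_iff, ← annAt_top]
  rw [← annAt_top] at hrank
  have h := isChartConstant_top.forall_mem_annAt_iff hL hrank
    (dfun (energy L) x : TS x →ₗ[ℝ] ℝ)
  rw [annFields_top] at h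
  exact h

/-- X is not assumed smooth, so Γ − X need not be a k-vector field; the pointwise description of the
annihilator is used instead. -/
theorem sopdeConstraint_of_mem_kPerp [T2Space Q] {L : T n k Q → ℝ}
    (X : ∀ x : T n k Q, Fin k → TS x) (Γ : KVField (J n k) (T n k Q) k)
    {Z : VField (J n k) (T n k Q)} (hZ : Z ∈ kPerp L) (x : T n k Q) :
    sopdeConstraint L Γ X Z x = 0 := by
  rw [← annFields_top, isChartConstant_top.mem_annFields_iff] at hZ
  exact mem_annihilatorAt.1 (hZ x) _ fun _ => Submodule.mem_top

/-- On P₁ the defect is η, and η vanishes identically for Z ∈ [𝔛ᵏ]^⊥, so those Z can be dropped from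
𝔐. -/
theorem S₁_eq_sopdeConstraint [T2Space Q] {L : T n k Q → ℝ}
    (hL : ContMDiff (J n k) 𝓘(ℝ, ℝ) ∞ L)
    {X : ∀ x : T n k Q, Fin k → TS x} (hX : ∀ x ∈ P₁ L, SolvesAt L x (X x))
    {Γ : KVField (J n k) (T n k Q) k} (hΓ : IsSOPDE Γ) (hrank : LocConstRank (𝔐At L)) :
    S₁ L X = {x ∈ P₁ L | ∀ Z ∈ 𝔐 L \ kPerp L, sopdeConstraint L Γ X Z x = 0} := by
  have h := S₁_eq_annihilator hL hX hΓ hrank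
  ext x
  constructor
  · intro hx
    refine ⟨hx.1, fun Z hZ => ?_⟩
    rw [← defect_apply_of_mem_P₁ hX Γ Z hx.1]
    rw [h] at hx
    exact hx Z hZ.1
  · rintro ⟨hx, hη⟩
    rw [h]
    intro Z hZ
    rw [defect_apply_of_mem_P₁ hX Γ Z hx]
    by_cases hZ' : Z ∈ kPerp L
    · exact sopdeConstraint_of_mem_kPerp X Γ hZ' x
    · exact hη Z ⟨hZ, hZ'⟩

end Constraints

end KSymplectic

end

theorem mainTheorem2 (n k : ℕ) (Q : Type*) [TopologicalSpace Q] [T2Space Q]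
    [SecondCountableTopology Q] [ChartedSpace (EuclideanSpace ℝ (Fin n)) Q]
    [IsManifold (𝓡 n) ∞ Q]
    (L : KSymplectic.T n k Q → ℝ) (hL : ContMDiff (KSymplectic.J n k) 𝓘(ℝ, ℝ) ∞ L)
    (X : ∀ x : KSymplectic.T n k Q, Fin k → KSymplectic.TS x)
    (hX : ∀ x ∈ KSymplectic.P₁ L, KSymplectic.SolvesAt L x (X x))
    (Γ : KVField (KSymplectic.J n k) (KSymplectic.T n k Q) k) (hΓ : KSymplectic.IsSOPDE Γ) :
    -- the description of `S₁` by the annihilator of the vertical `k`-vectors at each point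
    KSymplectic.S₁ L X = {x | ∀ z ∈ KSymplectic.𝔐At L x, KSymplectic.defect L Γ x z = 0} ∧
    -- the description of `S₁` by vector fields, where `𝔐` is regular
    (KSymplectic.LocConstRank (KSymplectic.𝔐At L) →
      KSymplectic.S₁ L X = {x | ∀ Z ∈ KSymplectic.𝔐 L, KSymplectic.defect L Γ x (Z x) = 0}) ∧
    -- the dynamical constraints
    KSymplectic.kPerp L ⊆ KSymplectic.𝔐 L ∧
    (∀ Z ∈ KSymplectic.kPerp L, ∀ x,
      KSymplectic.defect L Γ x (Z x) = -KSymplectic.dynConstraint L Z x) ∧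
    (KSymplectic.LocConstRank (KSymplectic.kPerpAt L) →
      KSymplectic.P₁ L = {x | ∀ Z ∈ KSymplectic.kPerp L, KSymplectic.dynConstraint L Z x = 0}) ∧
    -- the SOPDE constraints
    (∀ Z ∈ KSymplectic.𝔐 L \ KSymplectic.kPerp L, ∀ x ∈ KSymplectic.P₁ L,
      KSymplectic.defect L Γ x (Z x) = KSymplectic.sopdeConstraint L Γ X Z x) ∧
    (KSymplectic.LocConstRank (KSymplectic.𝔐At L) →
      KSymplectic.S₁ L X = {x ∈ KSymplectic.P₁ L | ∀ Z ∈ KSymplectic.𝔐 L \ KSymplectic.kPerp L,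
        KSymplectic.sopdeConstraint L Γ X Z x = 0}) :=
  ⟨KSymplectic.S₁_eq_annihilatorAt hX hΓ, KSymplectic.S₁_eq_annihilator hL hX hΓ,
    KSymplectic.kPerp_subset_𝔐 L, fun _ hZ => KSymplectic.defect_apply_of_mem_kPerp Γ hZ,
    KSymplectic.P₁_eq_dynConstraint hL,
    fun Z _ _ hx => KSymplectic.defect_apply_of_mem_P₁ hX Γ Z hx,
    KSymplectic.S₁_eq_sopdeConstraint hL hX hΓ⟩
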